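/- Let $t_0<t_f$, $A\in\mathbb R^{n\times n}$, $B\in\mathbb R^{n\times m}$, and suppose $(A,B)$ is controllable, i.e. $\operatorname{rank}[B,AB,\dots,A^{n-1}B]=n$. For $Q,F\in\mathbb S^n_+$ (positive semidefinite) and $R\in\mathbb S^m_{++}$ (positive definite), the optimal feedback matrix of the linear quadratic regulator $$\min_u\; x(t_f)^{\rm T}Fx(t_f)+\int_{t_0}^{t_f}\big(x^{\rm T}Qx+u^{\rm T}Ru\big)\,dt,\qquad \dot x=Ax+Bu,$$ is $K(t)=-R^{-1}B^{\rm T}P(t)$, $t\in[t_0,t_f]$, where $P$ is the solution on $[t_0,t_f]$ of the Riccati equation $\dot P=-A^{\rm T}P-PA+PBR^{-1}B^{\rm T}P-Q$, $P(t_f)=F$. Let $K:[t_0,t_f]\to\mathbb R^{m\times n}$ be given together with $R\in\mathcal R_s=\{R\in\mathbb S^m_{++}\mid RK(t)B=B^{\rm T}K(t)^{\rm T}R\ \ \forall t\in[t_0,t_f]\}$. Call a pair $(Q,F)\in\mathbb S^n_+\times\mathbb S^n_+$ a *solution* if $K$ is the optimal feedback matrix for $(Q,R,F)$. Notation. ${\rm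 vec}$ is column-stacking vectorization, ${\rm mat}$ its inverse, ${\rm vech}$ half-vectorization, $D_n$ the duplication matrix (${\rm vec}(X)=D_n{\rm vech}(X)$ for symmetric $X$), $M^\dagger$ the Moore–Penrose inverse, and $$\widetilde A=-I_n\otimes A-A\otimes I_n,\qquad \widetilde B=I_n\otimes B,$$ $$\widetilde H=[\widetilde B,\widetilde A\widetilde B,\dots,\widetilde A^{n^2}\widetilde B]^{\rm T},\qquad \widetilde N=[0,-\widetilde B,-\widetilde A\widetilde B,\dots,-\widetilde A^{n^2-1}\widetilde B]^{\rm T},$$ $$\widetilde H_{d_n}=\widetilde HD_n,\qquad \widetilde N_{d_n}=\widetilde ND_n,$$ $$P_0(t)=-K(t)^{\rm T}R\,(RK(t)B)^\dagger RK(t),\qquad F_0=P_0(t_f),$$ $$G(t)=A^{\rm T}P_0(t)+P_0(t)A+P_0(t)BK(t)+\dot P_0(t),$$ and $g(t)^{\rm T}=[g_0^{\rm T},g_1(t)^{\rm T},\dots,g_{n^2}(t)^{\rm T}]$ with $g_0=0\in\mathbb R^{nm}$ and $g_k(t)=-\sum_{i=0}^{k-1}\widetilde B^{\rm T}(\widetilde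 A^{\rm T})^i\,{\rm vec}\big(G^{(k-1-i)}(t)\big)$ for $1\le k\le n^2$ (derivatives are taken on $[t_0,t_f]$, hence one-sided at the endpoints). Then: 1. For every $F$ there is at most one $Q$ such that $(Q,F)$ is a solution, and for every $Q$ there is at most one $F$ such that $(Q,F)$ is a solution. 2. The matrices $\widetilde N_{d_n}^{\rm T}\widetilde N_{d_n}$ and $\widetilde H_{d_n}^{\rm T}\widetilde H_{d_n}$ are invertible. 3. Suppose that $P_0$ is $n^2$ times continuously differentiable on $[t_0,t_f]$ near $t_f$, including $t_f$ (one-sidedly), so that the derivatives in $g(t_f)$ exist. Then every solution $(Q,F)$ satisfies $$Q=-{\rm mat}\Big(D_n(\widetilde N_{d_n}^{\rm T}\widetilde N_{d_n})^{-1}\widetilde N_{d_n}^{\rm T}\big[\widetilde H_{d_n}{\rm vech}(F-F_0)+g(t_f)\big]\Big),$$ $$F=F_0-{\rm mat}\Big(D_n(\widetilde H_{d_n}^{\rm T}\widetilde H_{d_n})^{-1}\widetilde H_{d_n}^{\rm T}\big[\widetilde N_{d_n}{\rm vech}(Q)+g(t_f)\big]\Big).$$ -/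

import Mathlib

open Matrix Set
open scoped Kronecker

namespace InverseLQR

/-! ### Moore–Penrose inverse of a real matrix -/

section MoorePenrose

variable {a b : Type*} [Fintype a] [Fintype b]

/-- The four Penrose equations: `X` is the Moore–Penrose inverse of `M`. -/
structure IsMoorePenrose (M : Matrix a b ℝ) (X : Matrix b a ℝ) : Prop where
  mul_mul_left : M * X * M = M
  mul_mul_right : X * M * X = X
  symm_left : (M * X)ᵀ = M * X
  symm_right : (X * M)ᵀ = X * M

theorem IsMoorePenrose.unique {M : Matrix a b ℝ} {X Y : Matrix b a ℝ}
    (hX : IsMoorePenrose M X) (hY : IsMoorePenrose M Y) : X = Y := by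
  have h1 : M * X = M * Y := by
    calc M * X = (M * X)ᵀ := hX.symm_left.symm
      _ = ((M * Y) * (M * X))ᵀ := by rw [← Matrix.mul_assoc, hY.mul_mul_left]
      _ = (M * X) * (M * Y) := by rw [transpose_mul, hX.symm_left, hY.symm_left]
      _ = M * Y := by rw [← Matrix.mul_assoc, hX.mul_mul_left]
  have h2 : X * M = Y * M := by
    calc X * M = (X * M)ᵀ := hX.symm_right.symm
      _ = ((X * M) * (Y * M))ᵀ := by
          rw [Matrix.mul_assoc, ← Matrix.mul_assoc M, hY.mul_mul_left]
      _ = (Y * M) * (X * M) := by rw [transpose_mul, hX.symm_right, hY.symm_right]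
      _ = Y * M := by rw [Matrix.mul_assoc, ← Matrix.mul_assoc M, hX.mul_mul_left]
  calc X = X * M * X := hX.mul_mul_right.symm
    _ = Y * M * X := by rw [h2]
    _ = Y * M * Y := by rw [Matrix.mul_assoc, h1, Matrix.mul_assoc]
    _ = Y := hY.mul_mul_right

theorem exists_isMoorePenrose_of_isSymm (S : Matrix a a ℝ) (hS : Sᵀ = S) :
    ∃ X : Matrix a a ℝ, IsMoorePenrose S X ∧ Xᵀ = X := by
  classical
  have hH : S.IsHermitian := by
    rw [Matrix.IsHermitian, conjTranspose_eq_transpose_of_trivial, hS]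
  obtain ⟨U, d, hU, hd⟩ : ∃ (U : Matrix a a ℝ) (d : a → ℝ), Uᵀ * U = 1 ∧
      S = U * diagonal d * Uᵀ := by
    refine ⟨hH.eigenvectorUnitary, hH.eigenvalues, ?_, ?_⟩
    · have := Matrix.UnitaryGroup.star_mul_self hH.eigenvectorUnitary
      rwa [star_eq_conjTranspose, conjTranspose_eq_transpose_of_trivial] at this
    · have := hH.spectral_theorem
      rw [Unitary.conjStarAlgAut_apply] at this
      simpa [star_eq_conjTranspose, conjTranspose_eq_transpose_of_trivial,
        Function.comp_def] using this
  have key : ∀ e f : a → ℝ, U * diagonal e * Uᵀ * (U * diagonal f * Uᵀ)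
      = U * diagonal (fun i => e i * f i) * Uᵀ := by
    intro e f
    calc U * diagonal e * Uᵀ * (U * diagonal f * Uᵀ)
        = U * diagonal e * (Uᵀ * U) * diagonal f * Uᵀ := by simp only [Matrix.mul_assoc]
      _ = U * (diagonal e * diagonal f) * Uᵀ := by
          rw [hU, Matrix.mul_one]; simp only [Matrix.mul_assoc]
      _ = _ := by rw [diagonal_mul_diagonal]
  have tr : ∀ e : a → ℝ, (U * diagonal e * Uᵀ)ᵀ = U * diagonal e * Uᵀ := by
    intro e; simp [transpose_mul, Matrix.mul_assoc]
  refine ⟨U * diagonal (fun i => (d i)⁻¹) * Uᵀ, ⟨?_, ?_, ?_, ?_⟩, tr _⟩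
  · rw [hd, key, key]; congr 3; ext i; exact mul_inv_mul_cancel _
  · rw [hd, key, key]; congr 3; ext i
    by_cases h : d i = 0 <;> simp [h]
  · rw [hd, key, tr]
  · rw [hd, key, tr]

theorem exists_isMoorePenrose (M : Matrix a b ℝ) :
    ∃ X : Matrix b a ℝ, IsMoorePenrose M X := by
  obtain ⟨T, hT, hTs⟩ := exists_isMoorePenrose_of_isSymm (Mᵀ * M) (by simp [transpose_mul])
  have hM : M * (T * (Mᵀ * M)) = M := by
    have h0 : (M - M * (T * (Mᵀ * M)))ᴴ * (M - M * (T * (Mᵀ * M))) = 0 := by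
      rw [conjTranspose_eq_transpose_of_trivial]
      have e1 : (T * (Mᵀ * M))ᵀ = T * (Mᵀ * M) := hT.symm_right
      have e2 : Mᵀ * M * T * (Mᵀ * M) = Mᵀ * M := hT.mul_mul_left
      have e3 : (M * (T * (Mᵀ * M)))ᵀ = T * (Mᵀ * M) * Mᵀ := by rw [transpose_mul, e1]
      have e4 : Mᵀ * (M - M * (T * (Mᵀ * M))) = 0 := by
        rw [Matrix.mul_sub]
        simp only [← Matrix.mul_assoc] at e2 ⊢
        rw [e2, sub_self]
      rw [transpose_sub, e3, Matrix.sub_mul, Matrix.mul_assoc (T * (Mᵀ * M)), e4]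
      simp
    have := Matrix.conjTranspose_mul_self_eq_zero.mp h0
    exact (sub_eq_zero.mp this).symm
  refine ⟨T * Mᵀ, ⟨?_, ?_, ?_, ?_⟩⟩
  · simpa only [Matrix.mul_assoc] using hM
  · have := hT.mul_mul_right
    calc T * Mᵀ * M * (T * Mᵀ) = T * (Mᵀ * M) * T * Mᵀ := by simp only [Matrix.mul_assoc]
      _ = T * Mᵀ := by rw [this]
  · simp [transpose_mul, hTs, Matrix.mul_assoc]
  · simpa only [Matrix.mul_assoc] using hT.symm_right

/-- The Moore–Penrose inverse `M†`. -/
noncomputable def pinv (M : Matrix a b ℝ) : Matrix b a ℝ :=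
  Classical.choose (exists_isMoorePenrose M)

theorem pinv_spec (M : Matrix a b ℝ) : IsMoorePenrose M (pinv M) :=
  Classical.choose_spec (exists_isMoorePenrose M)

end MoorePenrose

/-! ### Vectorization

`Matrix.vec M` is the column-stacking vectorization; its entries are labelled by pairs
`(column, row)`, so that `vec (X * Y * Z) = (Zᵀ ⊗ₖ X) *ᵥ vec Y`. -/

/-- Labels `(row, column)` of the entries on and below the diagonal. -/
abbrev LowerIdx (n : ℕ) : Type := {p : Fin n × Fin n // p.2 ≤ p.1}

/-- Half-vectorization: the entries on and below the diagonal. -/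
def vech {n : ℕ} (M : Matrix (Fin n) (Fin n) ℝ) : LowerIdx n → ℝ :=
  fun p => M p.1.1 p.1.2

/-- Matricization, the inverse of `Matrix.vec`. -/
def mat {n : ℕ} (v : Fin n × Fin n → ℝ) : Matrix (Fin n) (Fin n) ℝ :=
  Matrix.of fun i j => v (j, i)

/-- The duplication matrix `Dₙ`. -/
def dupMatrix (n : ℕ) : Matrix (Fin n × Fin n) (LowerIdx n) ℝ :=
  Matrix.of fun c p => if p.1 = (c.2, c.1) ∨ p.1 = (c.1, c.2) then 1 else 0

theorem mat_vec {n : ℕ} (M : Matrix (Fin n) (Fin n) ℝ) : mat (vec M) = M := rfl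

theorem dupMatrix_mulVec_vech {n : ℕ} (M : Matrix (Fin n) (Fin n) ℝ) (hM : Mᵀ = M) :
    dupMatrix n *ᵥ vech M = vec M := by
  have hs : ∀ i j, M i j = M j i := fun i j => by
    conv_lhs => rw [← hM]
    rfl
  ext ⟨j, i⟩
  have main : ∀ p₀ : LowerIdx n, (p₀.1 = (i, j) ∨ p₀.1 = (j, i)) →
      (dupMatrix n *ᵥ vech M) (j, i) = M i j := by
    intro p₀ hp₀
    have huniq : ∀ p : LowerIdx n, (p.1 = (i, j) ∨ p.1 = (j, i)) → p = p₀ := by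
      rintro ⟨⟨r, c⟩, h⟩ hp
      obtain ⟨⟨r', c'⟩, h'⟩ := p₀
      simp only [Prod.mk.injEq, Subtype.mk.injEq] at *
      grind
    rw [mulVec, dotProduct, Finset.sum_eq_single p₀]
    · rcases hp₀ with h | h
      · simp [dupMatrix, vech, h]
      · simp [dupMatrix, vech, h, hs i j]
    · intro p _ hne
      have : ¬ (p.1 = (i, j) ∨ p.1 = (j, i)) := fun h => hne (huniq p h)
      simp [dupMatrix, this]
    · simp
  rcases le_total j i with h | h
  · exact main ⟨(i, j), h⟩ (Or.inl rfl)
  · exact main ⟨(j, i), h⟩ (Or.inr rfl)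

/-! ### The linear quadratic regulator on `[t₀, tf]` -/

section LQR

variable {n m : ℕ}

/-- The controllability matrix `[B, AB, …, Aⁿ⁻¹B]`. -/
def controllabilityMatrix (A : Matrix (Fin n) (Fin n) ℝ) (B : Matrix (Fin n) (Fin m) ℝ) :
    Matrix (Fin n) (Fin n × Fin m) ℝ :=
  Matrix.of fun i c => (A ^ (c.1 : ℕ) * B) i c.2

/-- The pair `(A, B)` is controllable. -/
def Controllable (A : Matrix (Fin n) (Fin n) ℝ) (B : Matrix (Fin n) (Fin m) ℝ) : Prop :=
  (controllabilityMatrix A B).rank = n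

/-- `P` solves on `[t₀, tf]` the differential Riccati equation
`P' = -AᵀP - PA + P B R⁻¹ Bᵀ P - Q`, `P(tf) = F` (derivatives at the two endpoints are
one-sided). -/
def SolvesDRE (t₀ tf : ℝ) (A : Matrix (Fin n) (Fin n) ℝ) (B : Matrix (Fin n) (Fin m) ℝ)
    (Q : Matrix (Fin n) (Fin n) ℝ) (R : Matrix (Fin m) (Fin m) ℝ)
    (F : Matrix (Fin n) (Fin n) ℝ) (P : ℝ → Matrix (Fin n) (Fin n) ℝ) : Prop :=
  (∀ t ∈ Icc t₀ tf, ∀ i j, HasDerivWithinAt (fun s => P s i j)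
    ((-(Aᵀ * P t) - P t * A + P t * B * R⁻¹ * Bᵀ * P t - Q) i j) (Icc t₀ tf) t) ∧
  P tf = F

/-- `K` is the optimal feedback matrix on `[t₀, tf]` of the linear quadratic regulator with
cost matrices `Q, R, F`: `K(t) = -R⁻¹BᵀP(t)` with `P` the solution of the Riccati equation. -/
def IsOptimalFeedback (t₀ tf : ℝ) (A : Matrix (Fin n) (Fin n) ℝ)
    (B : Matrix (Fin n) (Fin m) ℝ) (Q : Matrix (Fin n) (Fin n) ℝ)
    (R : Matrix (Fin m) (Fin m) ℝ) (F : Matrix (Fin n) (Fin n) ℝ)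
    (K : ℝ → Matrix (Fin m) (Fin n) ℝ) : Prop :=
  ∃ P : ℝ → Matrix (Fin n) (Fin n) ℝ, SolvesDRE t₀ tf A B Q R F P ∧
    ∀ t ∈ Icc t₀ tf, K t = -(R⁻¹ * Bᵀ * P t)

/-- `(Q, F)` solves the inverse problem for the given feedback matrix `K` and control cost
matrix `R`. -/
structure IsInverseSolution (t₀ tf : ℝ) (A : Matrix (Fin n) (Fin n) ℝ)
    (B : Matrix (Fin n) (Fin m) ℝ) (K : ℝ → Matrix (Fin m) (Fin n) ℝ)
    (R : Matrix (Fin m) (Fin m) ℝ) (Q F : Matrix (Fin n) (Fin n) ℝ) : Prop where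
  posSemidef_Q : Q.PosSemidef
  posSemidef_F : F.PosSemidef
  isOptimalFeedback : IsOptimalFeedback t₀ tf A B Q R F K

/-- The set `𝓡ₛ` of positive definite `R` with `R K(t) B = Bᵀ K(t)ᵀ R` on `[t₀, tf]`. -/
def Rs (t₀ tf : ℝ) (B : Matrix (Fin n) (Fin m) ℝ) (K : ℝ → Matrix (Fin m) (Fin n) ℝ) :
    Set (Matrix (Fin m) (Fin m) ℝ) :=
  {R | R.PosDef ∧ ∀ t ∈ Icc t₀ tf, R * K t * B = Bᵀ * (K t)ᵀ * R}

/-- `Ã = -Iₙ ⊗ A - A ⊗ Iₙ`. -/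
def tildeA (A : Matrix (Fin n) (Fin n) ℝ) : Matrix (Fin n × Fin n) (Fin n × Fin n) ℝ :=
  -((1 : Matrix (Fin n) (Fin n) ℝ) ⊗ₖ A) - A ⊗ₖ (1 : Matrix (Fin n) (Fin n) ℝ)

/-- `B̃ = Iₙ ⊗ B`. -/
def tildeB (B : Matrix (Fin n) (Fin m) ℝ) : Matrix (Fin n × Fin n) (Fin n × Fin m) ℝ :=
  (1 : Matrix (Fin n) (Fin n) ℝ) ⊗ₖ B

/-- `H̃ = [B̃, ÃB̃, …, Ã^(n²)B̃]ᵀ`; a row label `(k, r)` is row `r` of the block `(Ã^k B̃)ᵀ`. -/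
def tildeH (A : Matrix (Fin n) (Fin n) ℝ) (B : Matrix (Fin n) (Fin m) ℝ) :
    Matrix (Fin (n ^ 2 + 1) × (Fin n × Fin m)) (Fin n × Fin n) ℝ :=
  Matrix.of fun p c => (tildeA A ^ (p.1 : ℕ) * tildeB B)ᵀ p.2 c

/-- `Ñ = [0, -B̃, -ÃB̃, …, -Ã^(n²-1)B̃]ᵀ`. -/
def tildeN (A : Matrix (Fin n) (Fin n) ℝ) (B : Matrix (Fin n) (Fin m) ℝ) :
    Matrix (Fin (n ^ 2 + 1) × (Fin n × Fin m)) (Fin n × Fin n) ℝ :=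
  Matrix.of fun p c =>
    if (p.1 : ℕ) = 0 then 0 else -(tildeA A ^ ((p.1 : ℕ) - 1) * tildeB B)ᵀ p.2 c

/-- `H̃ Dₙ`. -/
def Hd (A : Matrix (Fin n) (Fin n) ℝ) (B : Matrix (Fin n) (Fin m) ℝ) :
    Matrix (Fin (n ^ 2 + 1) × (Fin n × Fin m)) (LowerIdx n) ℝ :=
  tildeH A B * dupMatrix n

/-- `Ñ Dₙ`. -/
def Nd (A : Matrix (Fin n) (Fin n) ℝ) (B : Matrix (Fin n) (Fin m) ℝ) :
    Matrix (Fin (n ^ 2 + 1) × (Fin n × Fin m)) (LowerIdx n) ℝ :=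
  tildeN A B * dupMatrix n

/-- `P₀(t) = -K(t)ᵀ R (R K(t) B)† R K(t)`. -/
noncomputable def P0 (B : Matrix (Fin n) (Fin m) ℝ) (K : ℝ → Matrix (Fin m) (Fin n) ℝ)
    (R : Matrix (Fin m) (Fin m) ℝ) (t : ℝ) : Matrix (Fin n) (Fin n) ℝ :=
  -((K t)ᵀ * R * pinv (R * K t * B) * R * K t)

/-- Entrywise `k`-th derivative of a matrix-valued function on `[t₀, tf]` (one-sided at the
endpoints). -/
noncomputable def matDeriv (t₀ tf : ℝ) (k : ℕ) (M : ℝ → Matrix (Fin n) (Fin n) ℝ) (t : ℝ) :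
    Matrix (Fin n) (Fin n) ℝ :=
  Matrix.of fun i j => iteratedDerivWithin k (fun s => M s i j) (Icc t₀ tf) t

/-- `G(t) = AᵀP₀(t) + P₀(t)A + P₀(t)BK(t) + P₀'(t)`. -/
noncomputable def G (t₀ tf : ℝ) (A : Matrix (Fin n) (Fin n) ℝ) (B : Matrix (Fin n) (Fin m) ℝ)
    (K : ℝ → Matrix (Fin m) (Fin n) ℝ) (R : Matrix (Fin m) (Fin m) ℝ) (t : ℝ) :
    Matrix (Fin n) (Fin n) ℝ :=
  Aᵀ * P0 B K R t + P0 B K R t * A + P0 B K R t * B * K t + matDeriv t₀ tf 1 (P0 B K R) t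

/-- The stacked vector `g(t)`: its block `k` is `-∑_{i<k} B̃ᵀ (Ãᵀ)^i vec(G^{(k-1-i)}(t))`
(hence block `0` is zero). -/
noncomputable def g (t₀ tf : ℝ) (A : Matrix (Fin n) (Fin n) ℝ) (B : Matrix (Fin n) (Fin m) ℝ)
    (K : ℝ → Matrix (Fin m) (Fin n) ℝ) (R : Matrix (Fin m) (Fin m) ℝ) (t : ℝ) :
    Fin (n ^ 2 + 1) × (Fin n × Fin m) → ℝ :=
  fun p => -∑ i ∈ Finset.range (p.1 : ℕ),
    (((tildeB B)ᵀ * (tildeA A)ᵀ ^ i) *ᵥ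
      vec (matDeriv t₀ tf ((p.1 : ℕ) - 1 - i) (G t₀ tf A B K R) t)) p.2

end LQR

end InverseLQR

namespace InverseLQR

open Filter Topology

/-! ### The Lyapunov operator and observability -/

section Lyapunov

variable {n m : ℕ}

/-! Let `P` be the Riccati solution behind a solution `(Q, F)`. It is symmetric and positive
semidefinite, and the feedback law says `Bᵀ P = -R K`. The quadratic Riccati term is therefore `-P B
K`, and `P' = L P - P B K - Q` with `L X = -Aᵀ X - X A`.

`P₀` is computed from `K` and `R` alone, yet `Bᵀ P₀ = Bᵀ P` (`transpose_mul_sandwich_eq`; this is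
where positivity of `P` enters). Hence `Z = P - P₀` satisfies `Bᵀ Z = 0` and `Z' = L Z - (G + Q)`,
the terms in `K` cancelling. Differentiating the constraint `k ≤ n²` times at `tf`
(`eventually_constraint_derivatives`) gives `Bᵀ (L^k Z - ∑_{i<k} L^i (G + Q)^{(k-1-i)}) = 0`. As `Q`
is constant, it survives only for `i = k - 1`. Vectorization turns `L` into `Ãᵀ`, and the stacked
equations read `H̃ vec (F - F₀) + Ñ vec Q + g(tf) = 0` (`IsInverseSolution.stacked_relation`).

Controllability makes the family `Bᵀ L^i`, `i < n`, jointly injective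
(`eq_zero_of_forall_lyap_pow`), so `H̃ Dₙ` and `Ñ Dₙ` have full column rank and least squares solves
for either unknown. Uniqueness needs no smoothness of `P₀`: the same differentiation applies to the
difference of two Riccati solutions, whose forcing is constant. -/

/-- The operator `X ↦ -AᵀX - XA`. -/
def lyap (A : Matrix (Fin n) (Fin n) ℝ) : Module.End ℝ (Matrix (Fin n) (Fin n) ℝ) :=
  -LinearMap.mulLeft ℝ Aᵀ - LinearMap.mulRight ℝ A

theorem lyap_apply (A X : Matrix (Fin n) (Fin n) ℝ) : lyap A X = -(Aᵀ * X) - X * A := rfl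

theorem vec_lyap (A X : Matrix (Fin n) (Fin n) ℝ) :
    vec (lyap A X) = (tildeA A)ᵀ *ᵥ vec X := by
  have h1 := kronecker_mulVec_vec Aᵀ X (1 : Matrix (Fin n) (Fin n) ℝ)
  have h2 := kronecker_mulVec_vec (1 : Matrix (Fin n) (Fin n) ℝ) X Aᵀ
  rw [transpose_one, Matrix.mul_one] at h1
  rw [transpose_transpose, Matrix.one_mul] at h2
  rw [lyap_apply, vec_sub, vec_neg, tildeA, transpose_sub, transpose_neg, sub_mulVec, neg_mulVec,
    ← kroneckerMap_transpose, ← kroneckerMap_transpose, transpose_one, h1, h2]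

theorem vec_lyap_pow (A X : Matrix (Fin n) (Fin n) ℝ) (k : ℕ) :
    vec ((lyap A ^ k) X) = (tildeA A)ᵀ ^ k *ᵥ vec X := by
  induction k with
  | zero => simp
  | succ k ih => rw [pow_succ', Module.End.mul_apply, vec_lyap, ih, pow_succ', mulVec_mulVec]

theorem tildeB_transpose_mulVec_vec (B : Matrix (Fin n) (Fin m) ℝ)
    (X : Matrix (Fin n) (Fin n) ℝ) : (tildeB B)ᵀ *ᵥ vec X = vec (Bᵀ * X) := by
  have h1 := kronecker_mulVec_vec Bᵀ X (1 : Matrix (Fin n) (Fin n) ℝ)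
  rw [transpose_one, Matrix.mul_one] at h1
  rw [tildeB, ← kroneckerMap_transpose, transpose_one, h1]

theorem tildeB_transpose_mul_pow_mulVec_vec (A : Matrix (Fin n) (Fin n) ℝ)
    (B : Matrix (Fin n) (Fin m) ℝ) (X : Matrix (Fin n) (Fin n) ℝ) (k : ℕ) :
    ((tildeB B)ᵀ * (tildeA A)ᵀ ^ k) *ᵥ vec X = vec (Bᵀ * (lyap A ^ k) X) := by
  rw [← mulVec_mulVec, ← vec_lyap_pow, tildeB_transpose_mulVec_vec]

theorem tildeH_mulVec_vec (A : Matrix (Fin n) (Fin n) ℝ) (B : Matrix (Fin n) (Fin m) ℝ)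
    (X : Matrix (Fin n) (Fin n) ℝ) (p : Fin (n ^ 2 + 1) × (Fin n × Fin m)) :
    (tildeH A B *ᵥ vec X) p = vec (Bᵀ * (lyap A ^ (p.1 : ℕ)) X) p.2 := by
  rw [← tildeB_transpose_mul_pow_mulVec_vec, ← transpose_pow, ← transpose_mul]
  rfl

theorem tildeN_mulVec_vec (A : Matrix (Fin n) (Fin n) ℝ) (B : Matrix (Fin n) (Fin m) ℝ)
    (X : Matrix (Fin n) (Fin n) ℝ) (p : Fin (n ^ 2 + 1) × (Fin n × Fin m)) :
    (tildeN A B *ᵥ vec X) p =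
      if (p.1 : ℕ) = 0 then 0 else -vec (Bᵀ * (lyap A ^ ((p.1 : ℕ) - 1)) X) p.2 := by
  split_ifs with h
  · have h' : p.1 = 0 := Fin.ext h
    simp [mulVec, dotProduct, tildeN, h']
  · rw [← tildeB_transpose_mul_pow_mulVec_vec, ← transpose_pow, ← transpose_mul]
    have h' : p.1 ≠ 0 := fun h0 => h (by rw [h0]; rfl)
    simp [mulVec, dotProduct, tildeN, h']

theorem eq_zero_of_controllable {A : Matrix (Fin n) (Fin n) ℝ} {B : Matrix (Fin n) (Fin m) ℝ}
    (hAB : Controllable A B) {X : Matrix (Fin n) (Fin n) ℝ}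
    (hX : ∀ j < n, (A ^ j * B)ᵀ * X = 0) : X = 0 := by
  set C := controllabilityMatrix A B
  have hCX : Cᵀ * X = 0 := by
    ext ⟨j, r⟩ c
    exact congrFun (congrFun (hX j j.2) r) c
  have hinj : Function.Injective Cᵀ.mulVec := by
    rw [mulVec_injective_iff, linearIndependent_iff_card_eq_finrank_span, Fintype.card_fin, Set.finrank,
      ← Matrix.rank_eq_finrank_span_cols, rank_transpose]
    exact hAB.symm
  ext i j
  have h0 : Cᵀ *ᵥ (fun k => X k j) = Cᵀ *ᵥ 0 := by
    rw [mulVec_zero]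
    ext p
    exact congrFun (congrFun hCX p) j
  exact congrFun (hinj h0) i

/-- If `C Y = 0` and `C L Y = 0`, then `C Aᵀ Y = 0`, because the other term `C Y A` of `C L Y`
vanishes. Each such step trades one power of `L` for one power of `Aᵀ`, until only the
controllability blocks act on `X`. -/
theorem eq_zero_of_forall_lyap_pow {A : Matrix (Fin n) (Fin n) ℝ}
    {B : Matrix (Fin n) (Fin m) ℝ} (hAB : Controllable A B) {X : Matrix (Fin n) (Fin n) ℝ}
    (hX : ∀ i < n, Bᵀ * (lyap A ^ i) X = 0) : X = 0 := by
  have key : ∀ j i, i + j < n → (A ^ j * B)ᵀ * (lyap A ^ i) X = 0 := by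
    intro j
    induction j with
    | zero => intro i hi; simpa using hX i hi
    | succ j ih =>
      intro i hi
      have h1 := ih (i + 1) (by omega)
      have h2 := ih i (by omega)
      rw [pow_succ', Module.End.mul_apply, lyap_apply, Matrix.mul_sub, Matrix.mul_neg,
        ← Matrix.mul_assoc, ← Matrix.mul_assoc, h2, Matrix.zero_mul, sub_zero, neg_eq_zero,
        ← transpose_mul, ← Matrix.mul_assoc, ← pow_succ'] at h1
      exact h1
  exact eq_zero_of_controllable hAB fun j hj => by simpa using key j 0 (by omega)

/-! ### Half-vectorization and full column rank -/

theorem le_sq_self (n : ℕ) : n ≤ n ^ 2 := Nat.le_self_pow two_ne_zero n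

theorem dupMatrix_mulVec_eq_vec (v : LowerIdx n → ℝ) :
    ∃ X : Matrix (Fin n) (Fin n) ℝ, vech X = v ∧ dupMatrix n *ᵥ v = vec X := by
  classical
  let X : Matrix (Fin n) (Fin n) ℝ := Matrix.of fun i j =>
    if h : j ≤ i then v ⟨(i, j), h⟩ else v ⟨(j, i), (not_le.mp h).le⟩
  have hX : Xᵀ = X := by
    ext i j
    rcases lt_trichotomy i j with h | rfl | h
    · simp [X, h.le, not_le.mpr h]
    · rfl
    · simp [X, h.le, not_le.mpr h]
  have hv : vech X = v := by
    ext ⟨⟨i, j⟩, h⟩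
    have h' : j ≤ i := h
    simp [vech, X, h']
  exact ⟨X, hv, by rw [← dupMatrix_mulVec_vech X hX, hv]⟩

theorem Hd_mulVec_vech (A : Matrix (Fin n) (Fin n) ℝ) (B : Matrix (Fin n) (Fin m) ℝ)
    {X : Matrix (Fin n) (Fin n) ℝ} (hX : Xᵀ = X) :
    Hd A B *ᵥ vech X = tildeH A B *ᵥ vec X := by
  rw [Hd, ← mulVec_mulVec, dupMatrix_mulVec_vech X hX]

theorem Nd_mulVec_vech (A : Matrix (Fin n) (Fin n) ℝ) (B : Matrix (Fin n) (Fin m) ℝ)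
    {X : Matrix (Fin n) (Fin n) ℝ} (hX : Xᵀ = X) :
    Nd A B *ᵥ vech X = tildeN A B *ᵥ vec X := by
  rw [Nd, ← mulVec_mulVec, dupMatrix_mulVec_vech X hX]

/-- A kernel vector `v` of the Gram matrix has `vᵀ Mᵀ M v = 0`, the sum of squares of `M v`. -/
theorem isUnit_det_transpose_mul_self {a b : Type*} [Fintype a] [Fintype b] [DecidableEq b]
    (M : Matrix a b ℝ) (hM : ∀ v, M *ᵥ v = 0 → v = 0) : IsUnit (Mᵀ * M).det := by
  rw [isUnit_iff_ne_zero]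
  intro h
  obtain ⟨v, hv, h0⟩ := exists_mulVec_eq_zero_iff.mpr h
  refine hv (hM v ?_)
  rw [← dotProduct_self_eq_zero, dotProduct_mulVec, vecMul_mulVec, ← dotProduct_mulVec,
    h0, dotProduct_zero]

theorem eq_zero_of_Hd_mulVec_eq_zero {A : Matrix (Fin n) (Fin n) ℝ}
    {B : Matrix (Fin n) (Fin m) ℝ} (hAB : Controllable A B) (v : LowerIdx n → ℝ)
    (hv : Hd A B *ᵥ v = 0) : v = 0 := by
  obtain ⟨X, rfl, hX⟩ := dupMatrix_mulVec_eq_vec v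
  rw [Hd, ← mulVec_mulVec, hX] at hv
  have : X = 0 := eq_zero_of_forall_lyap_pow hAB fun i hi => by
    rw [← vec_eq_zero_iff]
    ext q
    have := congrFun hv (⟨i, by have := le_sq_self n; omega⟩, q)
    rwa [tildeH_mulVec_vec] at this
  rw [this]; rfl

theorem eq_zero_of_Nd_mulVec_eq_zero {A : Matrix (Fin n) (Fin n) ℝ}
    {B : Matrix (Fin n) (Fin m) ℝ} (hAB : Controllable A B) (v : LowerIdx n → ℝ)
    (hv : Nd A B *ᵥ v = 0) : v = 0 := by
  obtain ⟨X, rfl, hX⟩ := dupMatrix_mulVec_eq_vec v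
  rw [Nd, ← mulVec_mulVec, hX] at hv
  have : X = 0 := eq_zero_of_forall_lyap_pow hAB fun i hi => by
    rw [← vec_eq_zero_iff]
    ext q
    -- Block `0` of `Ñ` is zero, so power `i` sits in block `i + 1`; it exists since `i + 1 ≤ n ≤
    -- n²`.
    have := congrFun hv (⟨i + 1, by have := le_sq_self n; omega⟩, q)
    rw [tildeN_mulVec_vec] at this
    simpa using this
  rw [this]; rfl

end Lyapunov

/-! ### Entrywise derivatives of matrix-valued functions -/

section MatrixDerivative

variable {a b c d : Type*}

/-- Entrywise derivative within a set. -/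
def HasMatDerivWithinAt (M : ℝ → Matrix a b ℝ) (M' : Matrix a b ℝ) (s : Set ℝ) (t : ℝ) : Prop :=
  ∀ i j, HasDerivWithinAt (fun x => M x i j) (M' i j) s t

/-- Expansion in matrix units reduces a linear functional to finitely many entries, so no norm on
matrices has to be chosen. -/
theorem HasMatDerivWithinAt.functional [Fintype a] [Fintype b] {M : ℝ → Matrix a b ℝ} {M' : Matrix a b ℝ} {s : Set ℝ}
    {t : ℝ} (h : HasMatDerivWithinAt M M' s t) (l : Matrix a b ℝ →ₗ[ℝ] ℝ) :
    HasDerivWithinAt (fun x => l (M x)) (l M') s t := by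
  classical
  have key : ∀ X : Matrix a b ℝ, l X = ∑ i, ∑ j, X i j * l (Matrix.single i j 1) := by
    intro X
    conv_lhs => rw [matrix_eq_sum_single X]
    simp only [map_sum]
    refine Finset.sum_congr rfl fun i _ => Finset.sum_congr rfl fun j _ => ?_
    rw [← smul_eq_mul, ← map_smul, smul_single, smul_eq_mul, mul_one]
  rw [show (fun x => l (M x)) = fun x => ∑ i, ∑ j, M x i j * l (Matrix.single i j 1) from
    funext fun x => key (M x), key M']
  exact HasDerivWithinAt.fun_sum fun i _ => HasDerivWithinAt.fun_sum fun j _ =>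
    (h i j).mul_const _

theorem HasMatDerivWithinAt.linear [Fintype a] [Fintype b] {M : ℝ → Matrix a b ℝ} {M' : Matrix a b ℝ} {s : Set ℝ}
    {t : ℝ} (h : HasMatDerivWithinAt M M' s t) (T : Matrix a b ℝ →ₗ[ℝ] Matrix c d ℝ) :
    HasMatDerivWithinAt (fun x => T (M x)) (T M') s t := fun i j =>
  h.functional (Matrix.entryLinearMap ℝ ℝ i j ∘ₗ T)

theorem HasMatDerivWithinAt.sub {M N : ℝ → Matrix a b ℝ} {M' N' : Matrix a b ℝ} {s : Set ℝ}
    {t : ℝ} (hM : HasMatDerivWithinAt M M' s t) (hN : HasMatDerivWithinAt N N' s t) :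
    HasMatDerivWithinAt (fun x => M x - N x) (M' - N') s t := fun i j => (hM i j).sub (hN i j)

theorem HasMatDerivWithinAt.transpose {M : ℝ → Matrix a b ℝ} {M' : Matrix a b ℝ} {s : Set ℝ}
    {t : ℝ} (hM : HasMatDerivWithinAt M M' s t) :
    HasMatDerivWithinAt (fun x => (M x)ᵀ) M'ᵀ s t := fun i j => hM j i

theorem HasMatDerivWithinAt.sum {ι : Type*} {u : Finset ι} {M : ι → ℝ → Matrix a b ℝ}
    {M' : ι → Matrix a b ℝ} {s : Set ℝ} {t : ℝ}
    (h : ∀ k ∈ u, HasMatDerivWithinAt (M k) (M' k) s t) :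
    HasMatDerivWithinAt (fun x => ∑ k ∈ u, M k x) (∑ k ∈ u, M' k) s t := fun i j => by
  simp only [Matrix.sum_apply]
  exact HasDerivWithinAt.fun_sum fun k hk => h k hk i j

theorem HasMatDerivWithinAt.eq_zero {M : ℝ → Matrix a b ℝ} {M' : Matrix a b ℝ} {s : Set ℝ}
    {t : ℝ} (h : HasMatDerivWithinAt M M' s t) (hs : UniqueDiffWithinAt ℝ s t)
    (h0 : ∀ᶠ x in 𝓝[s] t, M x = 0) (ht : t ∈ s) : M' = 0 := by
  ext i j
  refine hs.eq_deriv s (h i j) ((hasDerivWithinAt_const t s (0 : ℝ)).congr_of_eventuallyEq ?_ ?_)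
  · filter_upwards [h0] with x hx
    simp [hx]
  · simp [h0.self_of_nhdsWithin ht]

/-- Repeated differentiation of the constraint `C Z = 0` along `Z' = T Z - M`. -/
theorem eventually_constraint_derivatives [Fintype a] [Fintype b] {s : Set ℝ} {t₁ : ℝ} (hs : UniqueDiffOn ℝ s)
    (T : Module.End ℝ (Matrix a b ℝ)) {p q : Type*}
    (C : Matrix a b ℝ →ₗ[ℝ] Matrix p q ℝ) (Z : ℝ → Matrix a b ℝ) (M : ℕ → ℝ → Matrix a b ℝ)
    (N : ℕ) (hZ : ∀ᶠ t in 𝓝[s] t₁, HasMatDerivWithinAt Z (T (Z t) - M 0 t) s t)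
    (hM : ∀ k, k + 1 < N → ∀ᶠ t in 𝓝[s] t₁, HasMatDerivWithinAt (M k) (M (k + 1) t) s t)
    (hC : ∀ᶠ t in 𝓝[s] t₁, C (Z t) = 0) (k : ℕ) (hk : k ≤ N) :
    ∀ᶠ t in 𝓝[s] t₁,
      C ((T ^ k) (Z t) - ∑ i ∈ Finset.range k, (T ^ i) (M (k - 1 - i) t)) = 0 := by
  induction k with
  | zero => simpa using hC
  | succ k ih =>
    have hM' : ∀ᶠ t in 𝓝[s] t₁, ∀ i ∈ Finset.range k,
        HasMatDerivWithinAt (M (k - 1 - i)) (M (k - i) t) s t := by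
      rw [eventually_all_finset]
      intro i hi
      have hi' := Finset.mem_range.mp hi
      have := hM (k - 1 - i) (by omega)
      rwa [show k - 1 - i + 1 = k - i by omega] at this
    -- The identity must hold near `t`, not only at `t`, to be differentiated again; hence the
    -- induction runs on eventual statements.
    filter_upwards [eventually_eventually_nhdsWithin.mpr (ih (by omega)), hZ, hM',
      self_mem_nhdsWithin] with t h0 hZt hMt hts
    have hd := ((hZt.linear (T ^ k)).sub
      (HasMatDerivWithinAt.sum fun i hi => (hMt i hi).linear (T ^ i))).linear C
    have := hd.eq_zero (hs t hts) h0 hts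
    rw [← this, Finset.sum_range_succ, map_sub (T ^ k), pow_succ, Module.End.mul_apply]
    congr 1
    have e : ∀ i, k + 1 - 1 - i = k - i := fun i => by omega
    simp only [e, Nat.sub_self]
    abel

end MatrixDerivative

/-! ### Linear matrix differential equations -/

section LinearODE

theorem eq_zero_of_linear_ode {ι : Type*} [Fintype ι] {a b : ℝ} {W : ℝ → Matrix ι ι ℝ}
    (hW : ∀ i j, ContinuousOn (fun t => W t i j) (Icc a b)) {x : ℝ → ι → ℝ}
    (hx : ∀ t ∈ Icc a b, HasDerivWithinAt x (W t *ᵥ x t) (Icc a b) t) (hb : x b = 0)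
    {t : ℝ} (ht : t ∈ Icc a b) : x t = 0 := by
  have hc : ContinuousOn (fun t => ∑ i, ∑ j, |W t i j|) (Icc a b) :=
    continuousOn_finsetSum _ fun i _ => continuousOn_finsetSum _ fun j _ => (hW i j).abs
  obtain ⟨C, hC⟩ := isCompact_Icc.exists_bound_of_continuousOn hc
  have hC0 : 0 ≤ C := (norm_nonneg _).trans (hC t ht)
  -- The sum of all `|W t i j|` dominates the operator norm for the sup norm and is bounded on the
  -- compact interval. Uniqueness then runs backwards from `b`.
  have hLip : ∀ t ∈ Ioc a b, LipschitzOnWith C.toNNReal (fun y => W t *ᵥ y) univ := by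
    intro t ht
    refine LipschitzOnWith.of_dist_le_mul fun y _ z _ => ?_
    rw [dist_eq_norm, ← mulVec_sub, dist_eq_norm, Real.coe_toNNReal C hC0]
    refine (pi_norm_le_iff_of_nonneg (by positivity)).mpr fun i => ?_
    calc ‖(W t *ᵥ (y - z)) i‖ ≤ ∑ j, ‖W t i j * (y - z) j‖ := norm_sum_le _ _
      _ ≤ ∑ j, |W t i j| * ‖y - z‖ := by
          refine Finset.sum_le_sum fun j _ => ?_
          rw [norm_mul, Real.norm_eq_abs]
          exact mul_le_mul_of_nonneg_left (norm_le_pi_norm _ j) (abs_nonneg _)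
      _ = (∑ j, |W t i j|) * ‖y - z‖ := by rw [Finset.sum_mul]
      _ ≤ (∑ i, ∑ j, |W t i j|) * ‖y - z‖ := by
          refine mul_le_mul_of_nonneg_right ?_ (norm_nonneg _)
          exact Finset.single_le_sum (f := fun i => ∑ j, |W t i j|)
            (fun i _ => Finset.sum_nonneg fun j _ => abs_nonneg _) (Finset.mem_univ i)
      _ ≤ C * ‖y - z‖ := mul_le_mul_of_nonneg_right
          ((le_abs_self _).trans (hC t (Ioc_subset_Icc_self ht))) (norm_nonneg _)
  exact ODE_solution_unique_of_mem_Icc_left (v := fun t y => W t *ᵥ y) (s := fun _ => univ)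
    (g := fun _ => 0) hLip (fun t ht => (hx t ht).continuousWithinAt)
    (fun t ht => (hx t (Ioc_subset_Icc_self ht)).mono_of_mem_nhdsWithin
      (Icc_mem_nhdsLE_of_mem ht)) (fun _ _ => mem_univ _) continuousOn_const
    (fun t _ => by simpa using hasDerivWithinAt_const t (Iic t) (0 : ι → ℝ))
    (fun _ _ => mem_univ _) hb ht

variable {n : ℕ} {a b : ℝ}

theorem eq_zero_of_sylvester_ode {U V S : ℝ → Matrix (Fin n) (Fin n) ℝ}
    (hU : ∀ i j, ContinuousOn (fun t => U t i j) (Icc a b))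
    (hV : ∀ i j, ContinuousOn (fun t => V t i j) (Icc a b))
    (hS : ∀ t ∈ Icc a b, HasMatDerivWithinAt S (U t * S t + S t * V t) (Icc a b) t)
    (hb : S b = 0) {t : ℝ} (ht : t ∈ Icc a b) : S t = 0 := by
  have h1 : ∀ t, ((1 : Matrix (Fin n) (Fin n) ℝ) ⊗ₖ U t + (V t)ᵀ ⊗ₖ 1) *ᵥ vec (S t) =
      vec (U t * S t + S t * V t) := by
    intro t
    rw [add_mulVec, kronecker_mulVec_vec, kronecker_mulVec_vec, vec_add, transpose_one,
      Matrix.mul_one, Matrix.one_mul, transpose_transpose]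
  rw [← vec_eq_zero_iff]
  refine eq_zero_of_linear_ode (x := fun t => vec (S t))
    (W := fun t => (1 : Matrix (Fin n) (Fin n) ℝ) ⊗ₖ U t + (V t)ᵀ ⊗ₖ 1) ?_ ?_ ?_ ht
  · intro i j
    simp only [Matrix.add_apply, kroneckerMap_apply, transpose_apply]
    exact (continuousOn_const.mul (hU _ _)).add ((hV _ _).mul continuousOn_const)
  · intro t ht
    rw [h1, hasDerivWithinAt_pi]
    exact fun q => hS t ht q.2 q.1
  · rw [hb, vec_zero]

/-! ### Positivity along Lyapunov differential equations -/

theorem continuousOn_quadraticForm {X : ℝ → Matrix (Fin n) (Fin n) ℝ} {s : Set ℝ}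
    (hX : ∀ i j, ContinuousOn (fun t => X t i j) s) (u : Set (Fin n → ℝ)) :
    ContinuousOn (fun z : ℝ × (Fin n → ℝ) => z.2 ⬝ᵥ X z.1 *ᵥ z.2) (s ×ˢ u) := by
  have hcoord : ∀ i, ContinuousOn (fun z : ℝ × (Fin n → ℝ) => z.2 i) (s ×ˢ u) := fun i =>
    ((continuous_apply i).comp continuous_snd).continuousOn
  simp only [dotProduct, mulVec]
  refine continuousOn_finsetSum _ fun i _ => (hcoord i).mul
    (continuousOn_finsetSum _ fun j _ => ContinuousOn.mul ?_ (hcoord j))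
  exact (hX i j).comp continuousOn_fst fun z hz => hz.1

theorem isCompact_dotProduct_self_eq_one : IsCompact {v : Fin n → ℝ | v ⬝ᵥ v = 1} := by
  refine Metric.isCompact_of_isClosed_isBounded ?_ ?_
  · exact isClosed_eq (by simp only [dotProduct]; fun_prop) continuous_const
  · refine (Metric.isBounded_closedBall (x := (0 : Fin n → ℝ)) (r := 1)).subset fun v hv => ?_
    rw [mem_closedBall_zero_iff, pi_norm_le_iff_of_nonneg zero_le_one]
    intro i
    have h1 : v i * v i ≤ v ⬝ᵥ v :=
      Finset.single_le_sum (f := fun i => v i * v i) (fun i _ => mul_self_nonneg _)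
        (Finset.mem_univ i)
    rw [show v ⬝ᵥ v = 1 from hv] at h1
    rw [Real.norm_eq_abs]
    exact abs_le_one_iff_mul_self_le_one.mpr h1

/-- A symmetric matrix attains the minimum of its quadratic form on the unit sphere only at
eigenvectors. -/
theorem mulVec_eq_smul_of_isMinOn {X : Matrix (Fin n) (Fin n) ℝ} (hX : Xᵀ = X)
    {v : Fin n → ℝ} (hv : v ⬝ᵥ v = 1)
    (hmin : ∀ w : Fin n → ℝ, w ⬝ᵥ w = 1 → v ⬝ᵥ X *ᵥ v ≤ w ⬝ᵥ X *ᵥ w) :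
    X *ᵥ v = (v ⬝ᵥ X *ᵥ v) • v := by
  set μ := v ⬝ᵥ X *ᵥ v with hμ
  have hq : ∀ w, w ⬝ᵥ (X - μ • (1 : Matrix (Fin n) (Fin n) ℝ)) *ᵥ w =
      w ⬝ᵥ X *ᵥ w - μ * (w ⬝ᵥ w) := by
    intro w
    rw [sub_mulVec, smul_mulVec, one_mulVec, dotProduct_sub, dotProduct_smul, smul_eq_mul]
  -- Minimality, extended by homogeneity, makes `X - μ I` positive semidefinite. Its form vanishes
  -- at `v`, which forces `v` into its kernel.
  have hps : (X - μ • (1 : Matrix (Fin n) (Fin n) ℝ)).PosSemidef := by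
    refine PosSemidef.of_dotProduct_mulVec_nonneg ?_ fun w => ?_
    · rw [IsHermitian, conjTranspose_eq_transpose_of_trivial, transpose_sub, hX, transpose_smul,
        transpose_one]
    · rw [star_trivial, hq]
      by_cases hw : w = 0
      · simp [hw]
      have hpos : 0 < w ⬝ᵥ w := by
        have h1 : 0 ≤ w ⬝ᵥ w := Finset.sum_nonneg fun i _ => mul_self_nonneg _
        exact h1.lt_of_ne fun h => hw (dotProduct_self_eq_zero.mp h.symm)
      set r := (Real.sqrt (w ⬝ᵥ w))⁻¹
      have hr : r * r * (w ⬝ᵥ w) = 1 := by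
        rw [← mul_inv, Real.mul_self_sqrt hpos.le, inv_mul_cancel₀ hpos.ne']
      have h1 := hmin (r • w) (by
        rw [smul_dotProduct, dotProduct_smul, smul_eq_mul, smul_eq_mul, ← mul_assoc, hr])
      rw [mulVec_smul, smul_dotProduct, dotProduct_smul, smul_eq_mul, smul_eq_mul,
        ← mul_assoc] at h1
      have h2 := mul_le_mul_of_nonneg_right h1 hpos.le
      have h3 : r * r * (w ⬝ᵥ X *ᵥ w) * (w ⬝ᵥ w) = w ⬝ᵥ X *ᵥ w := by
        rw [mul_right_comm, hr, one_mul]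
      linarith
  have h0 := (hps.dotProduct_mulVec_zero_iff v).mp (by
    rw [star_trivial, hq, hv, mul_one, ← hμ, sub_self])
  rwa [sub_mulVec, smul_mulVec, one_mulVec, sub_eq_zero] at h0

/-- A minimum principle: if positivity fails, `exp (c s) * vᵀ P(s) v` has a negative minimum over
time and the unit sphere. It is attained before `b`, at an eigenvector, and there the equation makes
the time derivative negative. -/
theorem posSemidef_of_lyapunov_ode {P X M : ℝ → Matrix (Fin n) (Fin n) ℝ}
    (hX : ∀ i j, ContinuousOn (fun t => X t i j) (Icc a b))
    (hP : ∀ t ∈ Icc a b,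
      HasMatDerivWithinAt P (-((X t)ᵀ * P t) - P t * X t - M t) (Icc a b) t)
    (hsymm : ∀ t ∈ Icc a b, (P t)ᵀ = P t) (hM : ∀ t ∈ Icc a b, (M t).PosSemidef)
    (hb : (P b).PosSemidef) {t : ℝ} (ht : t ∈ Icc a b) : (P t).PosSemidef := by
  refine PosSemidef.of_dotProduct_mulVec_nonneg (by
    rw [IsHermitian, conjTranspose_eq_transpose_of_trivial, hsymm t ht]) fun x => ?_
  rw [star_trivial]
  by_contra! hneg
  set S := {v : Fin n → ℝ | v ⬝ᵥ v = 1} with hS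
  have hcomp : IsCompact (Icc a b ×ˢ S) := isCompact_Icc.prod isCompact_dotProduct_self_eq_one
  obtain ⟨C, hC⟩ := hcomp.exists_bound_of_continuousOn (continuousOn_quadraticForm hX S)
  have hPc : ∀ i j, ContinuousOn (fun t => P t i j) (Icc a b) := fun i j t ht =>
    (hP t ht i j).continuousWithinAt
  -- With `vᵀ X v ≤ C` and `μ < 0`, this choice gives `c μ - 2 μ vᵀ X v ≤ μ < 0`.
  set c := 2 * C + 1
  have hhc : ContinuousOn (fun z : ℝ × (Fin n → ℝ) => Real.exp (c * z.1) *
      (z.2 ⬝ᵥ P z.1 *ᵥ z.2)) (Icc a b ×ˢ S) :=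
    ContinuousOn.mul (by fun_prop) (continuousOn_quadraticForm hPc S)
  have hx0 : x ≠ 0 := by rintro rfl; simp at hneg
  have hpos : 0 < x ⬝ᵥ x := by
    have h1 : 0 ≤ x ⬝ᵥ x := Finset.sum_nonneg fun i _ => mul_self_nonneg _
    exact h1.lt_of_ne fun h => hx0 (dotProduct_self_eq_zero.mp h.symm)
  set r := (Real.sqrt (x ⬝ᵥ x))⁻¹ with hr0
  have hrpos : 0 < r := inv_pos.mpr (Real.sqrt_pos.mpr hpos)
  have hr : r * r * (x ⬝ᵥ x) = 1 := by
    rw [← mul_inv, Real.mul_self_sqrt hpos.le, inv_mul_cancel₀ hpos.ne']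
  have hmem : (t, r • x) ∈ Icc a b ×ˢ S := ⟨ht, by
    change (r • x) ⬝ᵥ (r • x) = 1
    rw [smul_dotProduct, dotProduct_smul, smul_eq_mul, smul_eq_mul, ← mul_assoc, hr]⟩
  obtain ⟨⟨τ, v⟩, ⟨hτ, hv⟩, hmin⟩ := hcomp.exists_isMinOn ⟨_, hmem⟩ hhc
  have hv1 : v ⬝ᵥ v = 1 := hv
  set μ := v ⬝ᵥ P τ *ᵥ v with hμdef
  have hμ : μ < 0 := by
    have h1 : Real.exp (c * τ) * μ ≤ Real.exp (c * t) * ((r • x) ⬝ᵥ P t *ᵥ (r • x)) :=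
      hmin hmem
    rw [mulVec_smul, smul_dotProduct, dotProduct_smul, smul_eq_mul, smul_eq_mul] at h1
    have h2 : Real.exp (c * t) * (r * (r * (x ⬝ᵥ P t *ᵥ x))) < 0 :=
      mul_neg_of_pos_of_neg (Real.exp_pos _)
        (mul_neg_of_pos_of_neg hrpos (mul_neg_of_pos_of_neg hrpos hneg))
    exact neg_of_mul_neg_right (h1.trans_lt h2) (Real.exp_pos _).le
  have hτb : τ < b := by
    refine hτ.2.lt_of_ne fun h => ?_
    have := hb.dotProduct_mulVec_nonneg v
    rw [star_trivial, ← h] at this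
    exact absurd this (not_le.mpr hμ)
  have heig : P τ *ᵥ v = μ • v := by
    refine mulVec_eq_smul_of_isMinOn (hsymm τ hτ) hv1 fun w hw => ?_
    have h1 : Real.exp (c * τ) * μ ≤ Real.exp (c * τ) * (w ⬝ᵥ P τ *ᵥ w) :=
      hmin (show (τ, w) ∈ Icc a b ×ˢ S from ⟨hτ, hw⟩)
    exact le_of_mul_le_mul_left h1 (Real.exp_pos _)
  have heig' : v ᵥ* P τ = μ • v := by rw [← heig, ← vecMul_transpose, hsymm τ hτ]
  have hval : v ⬝ᵥ (-((X τ)ᵀ * P τ) - P τ * X τ - M τ) *ᵥ v =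
      -2 * μ * (v ⬝ᵥ X τ *ᵥ v) - v ⬝ᵥ M τ *ᵥ v := by
    rw [sub_mulVec, sub_mulVec, neg_mulVec, ← mulVec_mulVec, ← mulVec_mulVec, heig,
      dotProduct_sub, dotProduct_sub, dotProduct_neg, dotProduct_mulVec v (P τ), heig',
      mulVec_smul, dotProduct_smul, smul_dotProduct, dotProduct_mulVec v (X τ)ᵀ,
      vecMul_transpose, dotProduct_comm (X τ *ᵥ v) v, smul_eq_mul]
    ring
  let l : Matrix (Fin n) (Fin n) ℝ →ₗ[ℝ] ℝ :=
    { toFun := fun Y => v ⬝ᵥ Y *ᵥ v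
      map_add' := fun Y Z => by rw [add_mulVec, dotProduct_add]
      map_smul' := fun k Y => by rw [smul_mulVec, dotProduct_smul, RingHom.id_apply] }
  have hd1 : HasDerivWithinAt (fun s => v ⬝ᵥ P s *ᵥ v)
      (-2 * μ * (v ⬝ᵥ X τ *ᵥ v) - v ⬝ᵥ M τ *ᵥ v) (Icc a b) τ := by
    rw [← hval]
    exact (hP τ hτ).functional l
  have hd2 : HasDerivWithinAt (fun s => Real.exp (c * s)) (Real.exp (c * τ) * c) (Icc a b) τ := by
    simpa using ((hasDerivWithinAt_id τ (Icc a b)).const_mul c).exp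
  have hd := hd2.mul hd1
  have hloc : IsLocalMinOn ((fun s => Real.exp (c * s)) * fun s => v ⬝ᵥ P s *ᵥ v) (Icc a b) τ := by
    refine IsMinOn.localize fun s hs => ?_
    exact hmin (show (s, v) ∈ Icc a b ×ˢ S from ⟨hs, hv⟩)
  -- The minimum may lie at the left endpoint, so only the derivative in the forward direction `b -
  -- τ` is used.
  have h0 := hloc.hasFDerivWithinAt_nonneg hd.hasFDerivWithinAt
    (sub_mem_posTangentConeAt_of_segment_subset
      ((convex_Icc a b).segment_subset hτ ⟨hτ.1.trans hτb.le, le_rfl⟩))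
  rw [ContinuousLinearMap.toSpanSingleton_apply, smul_eq_mul] at h0
  have h1 := nonneg_of_mul_nonneg_right h0 (sub_pos.mpr hτb)
  have h2 : 0 ≤ c * μ + (-2 * μ * (v ⬝ᵥ X τ *ᵥ v) - v ⬝ᵥ M τ *ᵥ v) := by
    refine nonneg_of_mul_nonneg_right (a := Real.exp (c * τ)) ?_ (Real.exp_pos _)
    linarith [hμdef]
  have h3 : 0 ≤ v ⬝ᵥ M τ *ᵥ v := by
    simpa using (hM τ hτ).dotProduct_mulVec_nonneg v
  have h4 : v ⬝ᵥ X τ *ᵥ v ≤ C :=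
    (le_abs_self _).trans (hC (τ, v) ⟨hτ, hv⟩)
  nlinarith

end LinearODE

/-! ### Solutions of the inverse problem -/

section InverseProblem

theorem pinv_transpose_of_isSymm {a : Type*} [Fintype a] {W : Matrix a a ℝ} (hW : Wᵀ = W) :
    (pinv W)ᵀ = pinv W := by
  have h := pinv_spec W
  refine IsMoorePenrose.unique (M := W) ⟨?_, ?_, ?_, ?_⟩ h
  · simpa [transpose_mul, hW, Matrix.mul_assoc] using congrArg transpose h.mul_mul_left
  · simpa [transpose_mul, hW, Matrix.mul_assoc] using congrArg transpose h.mul_mul_right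
  · simpa [transpose_mul, hW] using h.symm_right.symm
  · simpa [transpose_mul, hW] using h.symm_left.symm

variable {n m : ℕ}

open scoped MatrixOrder in
-- Factor `P = Cᵀ C` and put `N = C B`. The claim becomes the pseudoinverse identity `Nᵀ N (Nᵀ N)†
-- Nᵀ = Nᵀ`, multiplied on the right by `C`; here `T = -(Nᵀ N)†`.
theorem transpose_mul_sandwich_eq {P : Matrix (Fin n) (Fin n) ℝ} (hP : P.PosSemidef)
    (B : Matrix (Fin n) (Fin m) ℝ) {T : Matrix (Fin m) (Fin m) ℝ} (hTs : Tᵀ = T)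
    (hT : IsMoorePenrose (-(Bᵀ * P * B)) T) :
    Bᵀ * (-(P * B * T * Bᵀ * P)) = Bᵀ * P := by
  obtain ⟨C, hC⟩ := CStarAlgebra.nonneg_iff_eq_star_mul_self.mp hP.nonneg
  rw [star_eq_conjTranspose, conjTranspose_eq_transpose_of_trivial] at hC
  obtain ⟨N, hN⟩ : ∃ N, N = C * B := ⟨_, rfl⟩
  have hW : Bᵀ * P * B = Nᵀ * N := by
    rw [hC, hN, transpose_mul]; simp only [Matrix.mul_assoc]
  have hBP : Bᵀ * P = Nᵀ * C := by
    rw [hC, hN, transpose_mul, Matrix.mul_assoc]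
  have h1 : Nᵀ * N * T * (Nᵀ * N) = -(Nᵀ * N) := by
    have := hT.mul_mul_left
    rw [hW] at this
    simpa using this
  -- Call the left side `E`. Then `Nᵀ E = 0`, and `Eᵀ` is a multiple of `Nᵀ` from the left, so `Eᵀ E
  -- = 0`.
  have hE : N + N * T * (Nᵀ * N) = 0 := by
    have h2 : Nᵀ * (N + N * T * (Nᵀ * N)) = 0 := by
      rw [Matrix.mul_add, ← Matrix.mul_assoc Nᵀ (N * T), ← Matrix.mul_assoc Nᵀ N, h1, add_neg_cancel]
    rw [← Matrix.conjTranspose_mul_self_eq_zero, conjTranspose_eq_transpose_of_trivial,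
      transpose_add, transpose_mul (N * T), transpose_mul N T, Matrix.add_mul, h2,
      Matrix.mul_assoc, Matrix.mul_assoc, h2]
    simp
  have hEt : Nᵀ * N * T * Nᵀ = -Nᵀ := by
    have := congrArg transpose hE
    simp only [transpose_add, transpose_mul, transpose_transpose, hTs, transpose_zero] at this
    rw [eq_neg_iff_add_eq_zero, ← this, add_comm]
    simp only [Matrix.mul_assoc]
  calc Bᵀ * (-(P * B * T * Bᵀ * P)) = -(Bᵀ * P * B * T * (Bᵀ * P)) := by
        simp only [Matrix.mul_neg, Matrix.mul_assoc]
    _ = -(Nᵀ * N * T * Nᵀ * C) := by rw [hW, hBP]; simp only [Matrix.mul_assoc]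
    _ = Bᵀ * P := by rw [hEt, hBP]; simp

theorem continuousOn_mul_apply {a b c : Type*} [Fintype b] {X : ℝ → Matrix a b ℝ}
    {Y : ℝ → Matrix b c ℝ} {s : Set ℝ} (hX : ∀ i j, ContinuousOn (fun t => X t i j) s)
    (hY : ∀ i j, ContinuousOn (fun t => Y t i j) s) (i : a) (j : c) :
    ContinuousOn (fun t => (X t * Y t) i j) s := by
  simp only [Matrix.mul_apply]
  exact continuousOn_finsetSum _ fun k _ => (hX i k).mul (hY k j)

theorem contDiffWithinAt_mul_apply {a b c : Type*} [Fintype b] {X : ℝ → Matrix a b ℝ}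
    {Y : ℝ → Matrix b c ℝ} {s : Set ℝ} {t : ℝ} {k : WithTop ℕ∞}
    (hX : ∀ i j, ContDiffWithinAt ℝ k (fun t => X t i j) s t)
    (hY : ∀ i j, ContDiffWithinAt ℝ k (fun t => Y t i j) s t) (i : a) (j : c) :
    ContDiffWithinAt ℝ k (fun t => (X t * Y t) i j) s t := by
  simp only [Matrix.mul_apply]
  exact ContDiffWithinAt.sum fun l _ => (hX i l).mul (hY l j)

variable {t₀ tf : ℝ} {A : Matrix (Fin n) (Fin n) ℝ} {B : Matrix (Fin n) (Fin m) ℝ}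
  {K : ℝ → Matrix (Fin m) (Fin n) ℝ} {R : Matrix (Fin m) (Fin m) ℝ}
  {Q F : Matrix (Fin n) (Fin n) ℝ}

/-- With `S = P - Pᵀ`, the quadratic terms differ by `P E P - Pᵀ E Pᵀ = Pᵀ E S + S E P`. So `S`
solves a linear equation with zero terminal value. -/
theorem SolvesDRE.transpose_eq {P : ℝ → Matrix (Fin n) (Fin n) ℝ}
    (h : SolvesDRE t₀ tf A B Q R F P) (hQ : Qᵀ = Q) (hR : Rᵀ = R) (hF : Fᵀ = F) {t : ℝ}
    (ht : t ∈ Icc t₀ tf) : (P t)ᵀ = P t := by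
  have hPc : ∀ i j, ContinuousOn (fun t => P t i j) (Icc t₀ tf) := fun i j t ht =>
    (h.1 t ht i j).continuousWithinAt
  set E := B * R⁻¹ * Bᵀ with hE
  have hEs : Eᵀ = E := by
    rw [hE, transpose_mul, transpose_mul, transpose_transpose, transpose_nonsing_inv, hR,
      Matrix.mul_assoc]
  have h0 : P t - (P t)ᵀ = 0 := by
    refine eq_zero_of_sylvester_ode (S := fun t => P t - (P t)ᵀ)
      (U := fun t => -Aᵀ + (P t)ᵀ * E) (V := fun t => -A + E * P t) ?_ ?_ ?_ ?_ ht
    · exact fun i j => continuousOn_const.add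
        (continuousOn_mul_apply (X := fun t => (P t)ᵀ) (Y := fun _ => E) (fun i j => hPc j i)
          (fun _ _ => continuousOn_const) i j)
    · exact fun i j => continuousOn_const.add
        (continuousOn_mul_apply (X := fun _ => E) (fun _ _ => continuousOn_const) hPc i j)
    · intro t ht
      have hd : HasMatDerivWithinAt P
          (-(Aᵀ * P t) - P t * A + P t * B * R⁻¹ * Bᵀ * P t - Q) (Icc t₀ tf) t := h.1 t ht
      have e1 : P t * B * R⁻¹ * Bᵀ * P t = P t * E * P t := by
        simp only [hE, Matrix.mul_assoc]
      convert hd.sub hd.transpose using 1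
      rw [e1]
      simp only [transpose_sub, transpose_add, transpose_neg, transpose_mul, hQ, hEs,
        transpose_transpose]
      noncomm_ring
    · rw [h.2, hF, sub_self]
  exact (sub_eq_zero.mp h0).symm

/-- The Riccati solution behind a solution of the inverse problem. -/
theorem IsInverseSolution.exists_riccati (h : IsInverseSolution t₀ tf A B K R Q F)
    (hR : R.PosDef) :
    ∃ P : ℝ → Matrix (Fin n) (Fin n) ℝ, P tf = F ∧ ∀ t ∈ Icc t₀ tf,
      HasMatDerivWithinAt P (lyap A (P t) - P t * B * K t - Q) (Icc t₀ tf) t ∧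
      (P t)ᵀ = P t ∧ (P t).PosSemidef ∧ Bᵀ * P t = -(R * K t) := by
  obtain ⟨P, hP, hK⟩ := h.isOptimalFeedback
  have hRs : Rᵀ = R := by
    simpa [IsHermitian, conjTranspose_eq_transpose_of_trivial] using hR.1
  have hQs : Qᵀ = Q := by
    simpa [IsHermitian, conjTranspose_eq_transpose_of_trivial] using h.posSemidef_Q.1
  have hFs : Fᵀ = F := by
    simpa [IsHermitian, conjTranspose_eq_transpose_of_trivial] using h.posSemidef_F.1
  have hRu : IsUnit R.det := hR.det_pos.ne'.isUnit
  have hPs : ∀ t ∈ Icc t₀ tf, (P t)ᵀ = P t := fun t ht => hP.transpose_eq hQs hRs hFs ht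
  have hBP : ∀ t ∈ Icc t₀ tf, Bᵀ * P t = -(R * K t) := by
    intro t ht
    rw [hK t ht, Matrix.mul_neg, neg_neg, Matrix.mul_assoc R⁻¹, mul_nonsing_inv_cancel_left _ _ hRu]
  have hPB : ∀ t ∈ Icc t₀ tf, (K t)ᵀ * Bᵀ * P t = -((K t)ᵀ * R * K t) := by
    intro t ht
    rw [Matrix.mul_assoc, hBP t ht, Matrix.mul_neg, Matrix.mul_assoc]
  have hPBK : ∀ t ∈ Icc t₀ tf, P t * B * K t = -((K t)ᵀ * R * K t) := by
    intro t ht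
    have := congrArg transpose (hBP t ht)
    simp only [transpose_mul, transpose_neg, transpose_transpose, hPs t ht, hRs] at this
    rw [this, Matrix.neg_mul]
  have hd : ∀ t ∈ Icc t₀ tf,
      HasMatDerivWithinAt P (lyap A (P t) - P t * B * K t - Q) (Icc t₀ tf) t := by
    intro t ht
    have e : lyap A (P t) - P t * B * K t - Q =
        -(Aᵀ * P t) - P t * A + P t * B * R⁻¹ * Bᵀ * P t - Q := by
      rw [hK t ht, lyap_apply, Matrix.mul_neg, sub_neg_eq_add]
      simp only [Matrix.mul_assoc]
    rw [e]
    exact hP.1 t ht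
  have hPc : ∀ i j, ContinuousOn (fun t => P t i j) (Icc t₀ tf) := fun i j t ht =>
    (hd t ht i j).continuousWithinAt
  have hKc : ∀ i j, ContinuousOn (fun t => K t i j) (Icc t₀ tf) := by
    intro i j
    refine ContinuousOn.congr (f := fun t => -(R⁻¹ * Bᵀ * P t) i j)
      (continuousOn_mul_apply (X := fun _ => R⁻¹ * Bᵀ) (fun _ _ => continuousOn_const)
        hPc i j).neg fun t ht => ?_
    simp only [hK t ht, Matrix.neg_apply]
  refine ⟨P, hP.2, fun t ht => ⟨hd t ht, hPs t ht, ?_, hBP t ht⟩⟩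
  -- In closed-loop form the Riccati equation is a Lyapunov equation with semidefinite forcing `Q +
  -- Kᵀ R K`.
  refine posSemidef_of_lyapunov_ode (X := fun t => A + B * K t)
    (M := fun t => Q + (K t)ᵀ * R * K t) ?_ ?_ hPs ?_ (hP.2 ▸ h.posSemidef_F) ht
  · exact fun i j => continuousOn_const.add
      (continuousOn_mul_apply (X := fun _ => B) (fun _ _ => continuousOn_const) hKc i j)
  · intro t ht
    have e : -((A + B * K t)ᵀ * P t) - P t * (A + B * K t) - (Q + (K t)ᵀ * R * K t) =
        lyap A (P t) - P t * B * K t - Q := by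
      rw [transpose_add, transpose_mul, Matrix.add_mul, hPB t ht, Matrix.mul_add, lyap_apply,
        ← Matrix.mul_assoc]
      abel
    rw [e]
    exact hd t ht
  · intro t _
    have := hR.posSemidef.conjTranspose_mul_mul_same (K t)
    rw [conjTranspose_eq_transpose_of_trivial] at this
    exact h.posSemidef_Q.add this

theorem P0_transpose {t : ℝ} (hR : R ∈ Rs t₀ tf B K) (ht : t ∈ Icc t₀ tf) :
    (P0 B K R t)ᵀ = P0 B K R t := by
  have hRs : Rᵀ = R := by
    simpa [IsHermitian, conjTranspose_eq_transpose_of_trivial] using hR.1.1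
  have hW : (R * K t * B)ᵀ = R * K t * B := by
    rw [hR.2 t ht, transpose_mul, transpose_mul, transpose_transpose, transpose_transpose, hRs,
      ← Matrix.mul_assoc, hR.2 t ht]
  have hT := pinv_transpose_of_isSymm hW
  rw [P0, transpose_neg]
  generalize pinv (R * K t * B) = T at hT
  simp only [transpose_mul, transpose_transpose, hRs, hT, Matrix.mul_assoc]

theorem transpose_mul_P0 {P : Matrix (Fin n) (Fin n) ℝ} {t : ℝ} (hR : R ∈ Rs t₀ tf B K)
    (hP : P.PosSemidef) (hBP : Bᵀ * P = -(R * K t)) :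
    Bᵀ * P0 B K R t = Bᵀ * P := by
  have hRs : Rᵀ = R := by
    simpa [IsHermitian, conjTranspose_eq_transpose_of_trivial] using hR.1.1
  have hPs : Pᵀ = P := by
    simpa [IsHermitian, conjTranspose_eq_transpose_of_trivial] using hP.1
  have hPB : P * B = -((K t)ᵀ * R) := by
    have := congrArg transpose hBP
    simpa only [transpose_mul, transpose_neg, transpose_transpose, hPs, hRs] using this
  have hW : -(Bᵀ * P * B) = R * K t * B := by rw [hBP, Matrix.neg_mul, neg_neg]
  have hWs : (R * K t * B)ᵀ = R * K t * B := by
    rw [← hW, transpose_neg, transpose_mul, transpose_mul, transpose_transpose, hPs,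
      Matrix.mul_assoc]
  rw [← transpose_mul_sandwich_eq hP B (T := pinv (R * K t * B)) (pinv_transpose_of_isSymm hWs)
    (hW ▸ pinv_spec _), P0]
  congr 2
  rw [hPB, Matrix.mul_assoc _ Bᵀ, hBP]
  simp only [Matrix.neg_mul, Matrix.mul_neg, neg_neg, Matrix.mul_assoc]

/-- The constraints satisfied by the difference of two inverse solutions. -/
theorem IsInverseSolution.lyap_pow_difference {Q₁ Q₂ F₁ F₂ : Matrix (Fin n) (Fin n) ℝ}
    (ht : t₀ < tf) (hR : R.PosDef) (h₁ : IsInverseSolution t₀ tf A B K R Q₁ F₁)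
    (h₂ : IsInverseSolution t₀ tf A B K R Q₂ F₂) :
    (∀ k, Bᵀ * ((lyap A ^ (k + 1)) (F₁ - F₂) - (lyap A ^ k) (Q₁ - Q₂)) = 0) ∧
      Bᵀ * (F₁ - F₂) = 0 := by
  obtain ⟨P₁, hF₁, hP₁⟩ := h₁.exists_riccati hR
  obtain ⟨P₂, hF₂, hP₂⟩ := h₂.exists_riccati hR
  have hmem : tf ∈ Icc t₀ tf := right_mem_Icc.mpr ht.le
  have hBZ : ∀ t ∈ Icc t₀ tf, Bᵀ * (P₁ t - P₂ t) = 0 := fun t ht => by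
    rw [Matrix.mul_sub, (hP₁ t ht).2.2.2, (hP₂ t ht).2.2.2, sub_self]
  have hZB : ∀ t ∈ Icc t₀ tf, P₁ t * B = P₂ t * B := fun t ht => by
    have := congrArg transpose (hBZ t ht)
    rw [transpose_mul, transpose_transpose, transpose_sub, (hP₁ t ht).2.1, (hP₂ t ht).2.1,
      transpose_zero, Matrix.sub_mul, sub_eq_zero] at this
    exact this
  refine ⟨fun k => ?_, by simpa [hF₁, hF₂] using hBZ tf hmem⟩
  -- Since `P₁ B = P₂ B`, the terms in `K` cancel and the forcing is the constant `Q₁ - Q₂`; its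
  -- derivatives vanish, so every order `k` is available.
  have key := eventually_constraint_derivatives (t₁ := tf) (uniqueDiffOn_Icc ht) (lyap A)
    (mulLeftLinearMap (Fin n) ℝ Bᵀ) (fun t => P₁ t - P₂ t)
    (fun j _ => if j = 0 then Q₁ - Q₂ else 0) (k + 1) ?_ ?_ ?_ (k + 1) le_rfl
  · have h0 := key.self_of_nhdsWithin hmem
    rw [Finset.sum_range_succ, Finset.sum_eq_zero, hF₁, hF₂] at h0
    · simpa using h0
    · intro i hi
      rw [if_neg (by have := Finset.mem_range.mp hi; omega), map_zero]
  · filter_upwards [self_mem_nhdsWithin] with t ht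
    convert (hP₁ t ht).1.sub (hP₂ t ht).1 using 1
    rw [hZB t ht, map_sub, if_pos rfl]
    abel
  · intro j _
    refine Eventually.of_forall fun t i l => ?_
    simpa using hasDerivWithinAt_const t (Icc t₀ tf) _
  · filter_upwards [self_mem_nhdsWithin] with t ht
    exact hBZ t ht

/-! ### Smoothness of the data and the stacked relation -/

theorem hasMatDerivWithinAt_matDeriv {M : ℝ → Matrix (Fin n) (Fin n) ℝ} {N k : ℕ} (ht : t₀ < tf)
    (hM : ∀ i j, ContDiffWithinAt ℝ (N : WithTop ℕ∞) (fun t => M t i j) (Icc t₀ tf) tf)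
    (hk : k < N) :
    ∀ᶠ t in 𝓝[Icc t₀ tf] tf,
      HasMatDerivWithinAt (matDeriv t₀ tf k M) (matDeriv t₀ tf (k + 1) M t) (Icc t₀ tf) t := by
  have hmem : tf ∈ Icc t₀ tf := right_mem_Icc.mpr ht.le
  have hev : ∀ᶠ t in 𝓝[Icc t₀ tf] tf, ∀ i j,
      ContDiffWithinAt ℝ (N : WithTop ℕ∞) (fun t => M t i j) (Icc t₀ tf) t := by
    rw [eventually_all]; intro i
    rw [eventually_all]; intro j
    have := (hM i j).eventually (by simp)
    rwa [insert_eq_of_mem hmem] at this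
  filter_upwards [hev, self_mem_nhdsWithin] with t h hts i j
  have hd := (h i j).differentiableWithinAt_iteratedDerivWithin (m := k) (by exact_mod_cast hk)
    (by rw [insert_eq_of_mem hts]; exact uniqueDiffOn_Icc ht)
  have := hd.hasDerivWithinAt
  rw [← iteratedDerivWithin_succ] at this
  exact this

theorem contDiffWithinAt_derivWithin {f : ℝ → ℝ} {N : ℕ} {s : Set ℝ} {t : ℝ}
    (hf : ContDiffWithinAt ℝ ((N + 1 : ℕ) : WithTop ℕ∞) f s t) (hs : UniqueDiffOn ℝ s)
    (ht : t ∈ s) : ContDiffWithinAt ℝ (N : WithTop ℕ∞) (derivWithin f s) s t := by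
  have := (hf.fderivWithin_right hs (m := (N : WithTop ℕ∞)) (by push_cast; rfl) ht).clm_apply
    (contDiffWithinAt_const (c := (1 : ℝ)))
  exact this

/-- The stacked linear relation between `F - P₀(tf)`, `Q` and `g(tf)`. -/
theorem IsInverseSolution.stacked_relation (ht : t₀ < tf) (hR : R ∈ Rs t₀ tf B K) (hn : 0 < n)
    (hP0 : ∀ i j, ContDiffWithinAt ℝ ((n ^ 2 : ℕ) : WithTop ℕ∞)
      (fun t => P0 B K R t i j) (Icc t₀ tf) tf)
    (h : IsInverseSolution t₀ tf A B K R Q F) :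
    tildeH A B *ᵥ vec (F - P0 B K R tf) + tildeN A B *ᵥ vec Q + g t₀ tf A B K R tf = 0 := by
  obtain ⟨P, hF, hP⟩ := h.exists_riccati hR.1
  have hmem : tf ∈ Icc t₀ tf := right_mem_Icc.mpr ht.le
  have hud := uniqueDiffOn_Icc ht
  have hRu : IsUnit R.det := hR.1.det_pos.ne'.isUnit
  -- `G` contains `P₀'`, so it is only `N = n² - 1` times differentiable, exactly the highest order
  -- occurring in `g`.
  obtain ⟨N, hN⟩ : ∃ N, n ^ 2 = N + 1 := ⟨n ^ 2 - 1, by have := Nat.pow_pos (n := 2) hn; omega⟩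
  rw [hN] at hP0
  have hBP0 : ∀ t ∈ Icc t₀ tf, Bᵀ * P0 B K R t = Bᵀ * P t := fun t ht =>
    transpose_mul_P0 hR (hP t ht).2.2.1 (hP t ht).2.2.2
  have hP0B : ∀ t ∈ Icc t₀ tf, P0 B K R t * B = P t * B := fun t ht => by
    have := congrArg transpose (hBP0 t ht)
    rwa [transpose_mul, transpose_mul, transpose_transpose, P0_transpose hR ht,
      (hP t ht).2.1] at this
  have hP0' : ∀ i j, ContDiffWithinAt ℝ (N : WithTop ℕ∞)
      (fun t => P0 B K R t i j) (Icc t₀ tf) tf := fun i j =>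
    (hP0 i j).of_le (by exact_mod_cast Nat.le_succ N)
  -- `K` inherits its regularity from `P₀`, because `K = -R⁻¹ Bᵀ P₀` on the interval.
  have hKd : ∀ i j, ContDiffWithinAt ℝ (N : WithTop ℕ∞) (fun t => K t i j) (Icc t₀ tf) tf := by
    intro i j
    have h1 : ∀ t ∈ Icc t₀ tf, K t = -(R⁻¹ * Bᵀ) * P0 B K R t := by
      intro t ht
      rw [Matrix.neg_mul, Matrix.mul_assoc, hBP0 t ht, (hP t ht).2.2.2, Matrix.mul_neg, neg_neg,
        nonsing_inv_mul_cancel_left _ _ hRu]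
    refine ContDiffWithinAt.congr_of_mem (f := fun t => (-(R⁻¹ * Bᵀ) * P0 B K R t) i j)
      (contDiffWithinAt_mul_apply (X := fun _ => -(R⁻¹ * Bᵀ))
        (fun _ _ => contDiffWithinAt_const) hP0' i j)
      (fun t ht => ?_) hmem
    rw [← h1 t ht]
  have hG : ∀ i j, ContDiffWithinAt ℝ (N : WithTop ℕ∞)
      (fun t => G t₀ tf A B K R t i j) (Icc t₀ tf) tf := by
    intro i j
    have hc : ∀ {a b : Type} (X : Matrix a b ℝ) (i : a) (j : b),
        ContDiffWithinAt ℝ (N : WithTop ℕ∞) (fun _ : ℝ => X i j) (Icc t₀ tf) tf :=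
      fun _ _ _ => contDiffWithinAt_const
    refine (((contDiffWithinAt_mul_apply (hc Aᵀ) hP0' i j).add
      (contDiffWithinAt_mul_apply hP0' (hc A) i j)).add
      (contDiffWithinAt_mul_apply (contDiffWithinAt_mul_apply hP0' (hc B)) hKd i j)).add ?_
    simp only [matDeriv, Matrix.of_apply, iteratedDerivWithin_one]
    exact contDiffWithinAt_derivWithin (hP0 i j) hud hmem
  have key := eventually_constraint_derivatives (t₁ := tf) hud (lyap A)
    (mulLeftLinearMap (Fin n) ℝ Bᵀ) (fun t => P t - P0 B K R t)
    (fun j t => matDeriv t₀ tf j (G t₀ tf A B K R) t + if j = 0 then Q else 0) (n ^ 2) ?_ ?_ ?_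
  · ext p
    have h0 := (key p.1 (by omega)).self_of_nhdsWithin hmem
    have h1 : ∑ i ∈ Finset.range (p.1 : ℕ), (lyap A ^ i) (if (p.1 : ℕ) - 1 - i = 0 then Q else 0) =
        if (p.1 : ℕ) = 0 then 0 else (lyap A ^ ((p.1 : ℕ) - 1)) Q := by
      generalize (p.1 : ℕ) = k
      cases k with
      | zero => simp
      | succ k =>
        rw [Finset.sum_range_succ, Finset.sum_eq_zero]
        · simp
        · intro i hi
          rw [if_neg (by have := Finset.mem_range.mp hi; omega), map_zero]
    simp only [map_add, Finset.sum_add_distrib, h1, hF, mulLeftLinearMap_apply] at h0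
    rw [Pi.add_apply, Pi.add_apply, tildeH_mulVec_vec, tildeN_mulVec_vec, g]
    simp only [tildeB_transpose_mul_pow_mulVec_vec]
    rw [← vec_eq_zero_iff] at h0
    have h2 := congrFun h0 p.2
    rw [Matrix.mul_sub, Matrix.mul_add, Matrix.mul_sum, vec_sub, vec_add, vec_sum] at h2
    simp only [Pi.sub_apply, Pi.add_apply, Finset.sum_apply, Pi.zero_apply] at h2 ⊢
    split_ifs at h2 ⊢ with hp
    · simp only [Matrix.mul_zero, vec_zero, Pi.zero_apply] at h2
      linarith
    · linarith
  · filter_upwards [self_mem_nhdsWithin,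
      hasMatDerivWithinAt_matDeriv (k := 0) ht hP0 (Nat.succ_pos N)] with t hts hd
    have e0 : ∀ M : ℝ → Matrix (Fin n) (Fin n) ℝ, matDeriv t₀ tf 0 M = M := by
      intro M; ext t i j; simp [matDeriv]
    rw [e0] at hd
    rw [e0, if_pos rfl]
    convert (hP t hts).1.sub hd using 1
    rw [G, hP0B t hts, map_sub, lyap_apply A (P0 B K R t)]
    abel
  · intro k hk
    filter_upwards [hasMatDerivWithinAt_matDeriv (k := k) ht hG (by omega)] with t hd i j
    simpa using (hd i j).add_const ((if k = 0 then Q else 0 : Matrix (Fin n) (Fin n) ℝ) i j)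
  · filter_upwards [self_mem_nhdsWithin] with t hts
    rw [mulLeftLinearMap_apply, Matrix.mul_sub, hBP0 t hts, sub_self]

/-- `(Mᵀ M)⁻¹ Mᵀ` is a left inverse of `M`, and `w = -M v`. -/
theorem inv_mulVec_transpose_mulVec {a b : Type*} [Fintype a] [Fintype b] [DecidableEq b]
    {M : Matrix a b ℝ} (hM : IsUnit (Mᵀ * M).det) {v : b → ℝ} {w : a → ℝ}
    (h : M *ᵥ v + w = 0) : (Mᵀ * M)⁻¹ *ᵥ (Mᵀ *ᵥ w) = -v := by
  rw [eq_neg_of_add_eq_zero_right h, mulVec_neg, mulVec_neg, mulVec_mulVec v, mulVec_mulVec,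
    nonsing_inv_mul _ hM, one_mulVec]

theorem neg_mat_dupMatrix_mulVec_neg_vech {X : Matrix (Fin n) (Fin n) ℝ} (hX : Xᵀ = X) :
    -mat (dupMatrix n *ᵥ (-vech X)) = X := by
  rw [mulVec_neg, dupMatrix_mulVec_vech X hX, ← vec_neg, mat_vec, neg_neg]

end InverseProblem

end InverseLQR

/-! ### The main theorem -/

theorem mainTheorem5 {n m : ℕ} (t₀ tf : ℝ) (ht : t₀ < tf)
    (A : Matrix (Fin n) (Fin n) ℝ) (B : Matrix (Fin n) (Fin m) ℝ)
    (hAB : InverseLQR.Controllable A B)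
    (K : ℝ → Matrix (Fin m) (Fin n) ℝ)
    (R : Matrix (Fin m) (Fin m) ℝ) (hR : R ∈ InverseLQR.Rs t₀ tf B K) :
    -- given `F`, at most one `Q` is consistent with the data, and conversely
    (∀ F Q₁ Q₂ : Matrix (Fin n) (Fin n) ℝ,
      InverseLQR.IsInverseSolution t₀ tf A B K R Q₁ F →
      InverseLQR.IsInverseSolution t₀ tf A B K R Q₂ F → Q₁ = Q₂) ∧
    (∀ Q F₁ F₂ : Matrix (Fin n) (Fin n) ℝ,
      InverseLQR.IsInverseSolution t₀ tf A B K R Q F₁ →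
      InverseLQR.IsInverseSolution t₀ tf A B K R Q F₂ → F₁ = F₂) ∧
    -- the matrices inverted in the formulas are invertible
    IsUnit ((InverseLQR.Nd A B)ᵀ * InverseLQR.Nd A B).det ∧
    IsUnit ((InverseLQR.Hd A B)ᵀ * InverseLQR.Hd A B).det ∧
    -- the formulas, whenever the derivatives that `g(tf)` is made of exist
    ((∀ i j, ContDiffWithinAt ℝ ((n ^ 2 : ℕ) : WithTop ℕ∞)
        (fun t => InverseLQR.P0 B K R t i j) (Set.Icc t₀ tf) tf) →
      ∀ Q F : Matrix (Fin n) (Fin n) ℝ, InverseLQR.IsInverseSolution t₀ tf A B K R Q F →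
        Q = -InverseLQR.mat (InverseLQR.dupMatrix n *ᵥ
            (((InverseLQR.Nd A B)ᵀ * InverseLQR.Nd A B)⁻¹ *ᵥ
              ((InverseLQR.Nd A B)ᵀ *ᵥ
                (InverseLQR.Hd A B *ᵥ InverseLQR.vech (F - InverseLQR.P0 B K R tf) +
                  InverseLQR.g t₀ tf A B K R tf)))) ∧
        F = InverseLQR.P0 B K R tf +
          -InverseLQR.mat (InverseLQR.dupMatrix n *ᵥ
            (((InverseLQR.Hd A B)ᵀ * InverseLQR.Hd A B)⁻¹ *ᵥ
              ((InverseLQR.Hd A B)ᵀ *ᵥ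
                (InverseLQR.Nd A B *ᵥ InverseLQR.vech Q +
                  InverseLQR.g t₀ tf A B K R tf))))) := by
  have hN : IsUnit ((InverseLQR.Nd A B)ᵀ * InverseLQR.Nd A B).det :=
    InverseLQR.isUnit_det_transpose_mul_self _ (InverseLQR.eq_zero_of_Nd_mulVec_eq_zero hAB)
  have hH : IsUnit ((InverseLQR.Hd A B)ᵀ * InverseLQR.Hd A B).det :=
    InverseLQR.isUnit_det_transpose_mul_self _ (InverseLQR.eq_zero_of_Hd_mulVec_eq_zero hAB)
  refine ⟨fun F Q₁ Q₂ h₁ h₂ => ?_, fun Q F₁ F₂ h₁ h₂ => ?_, hN, hH, fun hP0 Q F h => ?_⟩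
  · have hd := (h₁.lyap_pow_difference ht hR.1 h₂).1
    refine sub_eq_zero.mp (InverseLQR.eq_zero_of_forall_lyap_pow hAB fun i _ => ?_)
    simpa only [sub_self, map_zero, zero_sub, Matrix.mul_neg, neg_eq_zero] using hd i
  · have hd := h₁.lyap_pow_difference ht hR.1 h₂
    refine sub_eq_zero.mp (InverseLQR.eq_zero_of_forall_lyap_pow hAB fun i _ => ?_)
    -- Order `0` is the undifferentiated constraint `Bᵀ (F₁ - F₂) = 0`; higher orders come from its
    -- derivatives.
    cases i with
    | zero => simpa using hd.2
    | succ i => simpa using hd.1 i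
  · rcases Nat.eq_zero_or_pos n with rfl | hn
    -- For `n = 0` all matrices are empty; the stacked relation is proved for `n > 0`, where `n² -
    -- 1` is a genuine predecessor.
    · exact ⟨Subsingleton.elim _ _, Subsingleton.elim _ _⟩
    have hQs : Qᵀ = Q := by
      simpa [IsHermitian, conjTranspose_eq_transpose_of_trivial] using h.posSemidef_Q.1
    have hFs : Fᵀ = F := by
      simpa [IsHermitian, conjTranspose_eq_transpose_of_trivial] using h.posSemidef_F.1
    have hZs : (F - InverseLQR.P0 B K R tf)ᵀ = F - InverseLQR.P0 B K R tf := by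
      rw [transpose_sub, hFs, InverseLQR.P0_transpose hR (right_mem_Icc.mpr ht.le)]
    have hrel := h.stacked_relation ht hR hn hP0
    rw [← InverseLQR.Hd_mulVec_vech A B hZs, ← InverseLQR.Nd_mulVec_vech A B hQs] at hrel
    constructor
    · rw [InverseLQR.inv_mulVec_transpose_mulVec hN (v := InverseLQR.vech Q)
        (by rw [← hrel]; abel), InverseLQR.neg_mat_dupMatrix_mulVec_neg_vech hQs]
    · rw [InverseLQR.inv_mulVec_transpose_mulVec hH
        (v := InverseLQR.vech (F - InverseLQR.P0 B K R tf)) (by rw [← hrel]; abel),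
        InverseLQR.neg_mat_dupMatrix_mulVec_neg_vech hZs, add_sub_cancel]
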